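/- Let $\sigma$ be the uniform probability measure on the unit circle in $\mathbb{R}^2$ centered at the origin, and for $\lambda>0$ let $\sigma_\lambda(E)=\sigma(\lambda^{-1}E)$. For every $\delta\in(0,1)$ there exist a positive integer $J=J(\delta)$ and a constant $c=c(\delta)>0$, both depending only on $\delta$, with the following property. Let $\lambda_1,\dots,\lambda_J>1$ satisfy $2\lambda_k\le\lambda_{k+1}$ for $k=1,\dots,J-1$, and let $R>0$ and $M\ge 1$ be such that $\lambda_1,\dots,\lambda_J\in[M,R/2]$. Let $z\in\mathbb{R}^2$ and let $A,B\subseteq z+[0,R]^2$ be (Lebesgue) measurable sets with $$\inf_{M\le r\le R/2}\frac{1}{(2r)^2}\int_{z+[0,R]^2}\int_{\mathbb{R}^2}\mathbf{1}_A(x)\,\mathbf{1}_B(y)\,\mathbf{1}_{[-r,r]^2}(x-y)\,dy\,dx>\delta R^2 .$$ Then there exists $j\in\{1,\dots,J\}$ such that $$\int_{\mathbb{R}^2}\int_{\mathbb{R}^2}\mathbf{1}_A(x)\,\mathbf{1}_B(x+v)\,d\sigma_{\lambda_j}(v)\,dx\ \ge\ c\,R^2 .$$ -/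

import Mathlib

open MeasureTheory

noncomputable section

/-- The Euclidean plane. -/
abbrev Plane : Type := EuclideanSpace ℝ (Fin 2)

/-- The indicator function of a set in the plane, with values in `{0, 1} ⊆ ℝ`. -/
def ind (A : Set Plane) : Plane → ℝ := A.indicator (fun _ => 1)

/-- The closed axis-parallel square `z + [0, R]²`. -/
def square (z : Plane) (R : ℝ) : Set Plane :=
  {x | ∀ i, x i ∈ Set.Icc (z i) (z i + R)}

/-- The closed centred square `[-r, r]²`. -/
def centredSquare (r : ℝ) : Set Plane :=
  {x | ∀ i, x i ∈ Set.Icc (-r) r}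

/-- The uniform probability measure on the unit circle centred at the origin: the image of the
normalized Lebesgue measure on `(0, 2π]` under the arclength parametrization. -/
def circleMeasure : Measure Plane :=
  (ENNReal.ofReal (2 * Real.pi))⁻¹ •
    (volume.restrict (Set.Ioc 0 (2 * Real.pi))).map
      (fun θ : ℝ => (!₂[Real.cos θ, Real.sin θ] : Plane))

/-- The dilate `μ_t(E) = μ(t⁻¹ E)` of a measure on the plane. -/
def dilate (μ : Measure Plane) (t : ℝ) : Measure Plane :=
  μ.map (fun v => t • v)

/-- The measure of the pairs in `A × B` with displacement in `[-r, r]²`, normalized: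
`(2r)⁻² ∫_{z+[0,R]²} ∫_{ℝ²} 1_A(x) 1_B(y) 1_{[-r,r]²}(x - y) dy dx`. -/
def localPairAverage (A B : Set Plane) (z : Plane) (R r : ℝ) : ℝ :=
  1 / (2 * r) ^ 2 *
    ∫ x in square z R, ∫ y, ind A x * ind B y * ind (centredSquare r) (x - y)

/-- The counting form `∫ ∫ 1_A(x) 1_B(x + v) dσ_t(v) dx` of pairs at distance `t`. -/
def circleCount (A B : Set Plane) (t : ℝ) : ℝ :=
  ∫ x, ∫ v, ind A x * ind B (x + v) ∂(dilate circleMeasure t)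

end

/-! With `f`, `h` the indicators of `A`, `B` in L², the circle count at scale `t` and the local pair
average are `⟪f, S h⟫`, where `S` averages translates over the circle and over the square
respectively (`inner_avg_eq_pairForm`, `localPairAverage_eq_pairForm`). Let `D_t` be the difference
of these operators. If every circle count were below `δ/2 * R²`, each `⟪f, D_t h⟫` would be below
`-(δ/2) * R²`. This contradicts Cauchy–Schwarz as soon as the sum of `D_t` over `K` chosen scales
has norm at most `(δ/2) * K`, because `f` and `h` have norm at most `R`.

That norm bound is almost orthogonality (`norm_sum_sq_le_of_almost_orthogonal`). The `D_t` commute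
and are symmetric, so it suffices that `D_s D_t²` is small for `s` much smaller than `t`. Now `D_t²`
combines averages against dilates of convolutions of two measures. All of these are absolutely
continuous, even circle with circle, so their outputs barely change under translations of size
`O(s)`, and `D_s` nearly kills such functions. No rate of Fourier decay is needed. -/

/-! ### Translations and averaging operators on L² -/

/-- The real Hilbert space of square-integrable functions on the plane. -/
abbrev PlaneL2 : Type := Lp ℝ 2 (volume : Measure Plane)

/-- The translation `h ↦ h(v + ·)` on `L²`. -/
noncomputable def shift (v : Plane) : PlaneL2 →ₗᵢ[ℝ] PlaneL2 where
  toFun h := DomAddAct.mk v +ᵥ h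
  map_add' f g := DomAddAct.vadd_Lp_add _ f g
  map_smul' c f := by
    rcases f with ⟨⟨_⟩, _⟩
    rfl
  norm_map' f := DomAddAct.norm_vadd_Lp _ f

lemma shift_apply (v : Plane) (h : PlaneL2) : shift v h = DomAddAct.mk v +ᵥ h := rfl

lemma shift_shift (v w : Plane) (h : PlaneL2) :
    shift v (shift w h) = shift (v + w) h := by
  rw [shift_apply, shift_apply, shift_apply, vadd_vadd, ← DomAddAct.mk_add, add_comm]

@[simp]
lemma shift_zero (h : PlaneL2) : shift 0 h = h := by
  rw [shift_apply, DomAddAct.mk_zero, zero_vadd]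

lemma coeFn_shift (v : Plane) (h : PlaneL2) :
    shift v h =ᵐ[volume] fun x => h (v + x) :=
  DomAddAct.vadd_Lp_ae_eq _ _

lemma continuous_shift (h : PlaneL2) : Continuous fun v => shift v h := by
  have : Fact ((2 : ENNReal) ≠ ⊤) := ⟨by simp⟩
  exact (DomAddAct.continuous_mk).vadd continuous_const

lemma inner_shift_left (v : Plane) (f h : PlaneL2) :
    inner ℝ (shift v f) h = inner ℝ f (shift (-v) h) := by
  rw [← (shift v).inner_map_map f (shift (-v) h), shift_shift]
  simp

lemma integrable_shift (μ : Measure Plane) [IsFiniteMeasure μ] (h : PlaneL2) :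
    Integrable (fun v => shift v h) μ :=
  .of_bound (continuous_shift h).aestronglyMeasurable ‖h‖ (.of_forall fun v => by simp)

/-- The average of the translates of an `L²` function against a probability measure. -/
noncomputable def avg (μ : Measure Plane) [IsProbabilityMeasure μ] : PlaneL2 →L[ℝ] PlaneL2 :=
  LinearMap.mkContinuous
    { toFun := fun h => ∫ v, shift v h ∂μ
      map_add' := fun f g => by
        simp only [map_add]
        exact integral_add (integrable_shift μ f) (integrable_shift μ g)
      map_smul' := fun c f => by
        simp only [map_smul, RingHom.id_apply]
        exact integral_smul c _ }
    1 fun h => by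
      refine (norm_integral_le_of_norm_le_const (C := ‖h‖) (.of_forall fun v => by simp)).trans ?_
      simp

section

variable (μ ν : Measure Plane) [IsProbabilityMeasure μ] [IsProbabilityMeasure ν]

lemma avg_apply (h : PlaneL2) : avg μ h = ∫ v, shift v h ∂μ := rfl

lemma norm_avg_le (h : PlaneL2) : ‖avg μ h‖ ≤ ‖h‖ := by
  simpa using (avg μ).le_of_opNorm_le (LinearMap.mkContinuous_norm_le _ zero_le_one _) h

lemma shift_avg (v : Plane) (h : PlaneL2) :
    shift v (avg μ h) = ∫ w, shift (v + w) h ∂μ := by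
  rw [avg_apply]
  refine ((shift v).toContinuousLinearMap.integral_comp_comm
    (integrable_shift μ h)).symm.trans ?_
  exact integral_congr_ae (.of_forall fun w => shift_shift v w h)

/-- Source of both commutativity and the smoothing effect: a product of two averages sees only the
convolution, which may be absolutely continuous when a factor is singular. -/
lemma avg_avg (h : PlaneL2) : avg μ (avg ν h) = avg (μ.conv ν) h := by
  rw [avg_apply, avg_apply (μ.conv ν), show μ.conv ν = (μ.prod ν).map fun x => x.1 + x.2 from rfl,
    integral_map (by fun_prop)
    (continuous_shift h).aestronglyMeasurable, integral_prod]
  · exact integral_congr_ae (.of_forall fun v => shift_avg ν v h)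
  · exact .of_bound ((continuous_shift h).comp (by fun_prop)).aestronglyMeasurable ‖h‖
      (.of_forall fun v => by simp)

lemma avg_comm (h : PlaneL2) : avg μ (avg ν h) = avg ν (avg μ h) := by
  simp only [avg_avg, Measure.conv_comm μ ν]

lemma inner_avg_right (f h : PlaneL2) :
    inner ℝ f (avg μ h) = ∫ v, inner ℝ f (shift v h) ∂μ :=
  (integral_inner (integrable_shift μ h) f).symm

lemma avg_symmetric [μ.IsNegInvariant] (f h : PlaneL2) :
    inner ℝ (avg μ f) h = inner ℝ f (avg μ h) := by
  rw [inner_avg_right, real_inner_comm, inner_avg_right]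
  rw [← integral_neg_eq_self]
  refine integral_congr_ae (.of_forall fun v => ?_)
  simp only
  rw [← inner_shift_left, real_inner_comm]

lemma norm_avg_sub_self_le {g : PlaneL2} {C : ℝ} (hg : ∀ᵐ v ∂μ, ‖shift v g - g‖ ≤ C) :
    ‖avg μ g - g‖ ≤ C := by
  have : avg μ g - g = ∫ v, (shift v g - g) ∂μ := by
    rw [integral_sub (integrable_shift μ g) (integrable_const _), avg_apply]
    simp
  rw [this]
  simpa using norm_integral_le_of_norm_le_const hg

end

/-! ### Dilates of measures -/

lemma measurable_smul_plane (t : ℝ) : Measurable fun v : Plane => t • v :=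
  (continuous_const_smul t).measurable

instance isProbabilityMeasure_dilate (μ : Measure Plane) [IsProbabilityMeasure μ] (t : ℝ) :
    IsProbabilityMeasure (dilate μ t) :=
  Measure.isProbabilityMeasure_map (measurable_smul_plane t).aemeasurable

lemma dilate_conv (μ ν : Measure Plane) [SFinite μ] [SFinite ν] (t : ℝ) :
    dilate (μ.conv ν) t = (dilate μ t).conv (dilate ν t) :=
  Measure.map_conv_continuousLinearMap (t • ContinuousLinearMap.id ℝ Plane)

instance isNegInvariant_dilate (μ : Measure Plane) [μ.IsNegInvariant] (t : ℝ) :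
    (dilate μ t).IsNegInvariant := by
  refine ⟨?_⟩
  rw [Measure.neg, dilate, Measure.map_map measurable_neg (measurable_smul_plane t)]
  nth_rw 2 [← Measure.neg_eq_self μ]
  rw [Measure.neg, Measure.map_map (measurable_smul_plane t) measurable_neg]
  congr 1
  ext1 v
  simp

lemma ae_dilate_norm_le {μ : Measure Plane} {C : ℝ} (hμ : ∀ᵐ v ∂μ, ‖v‖ ≤ C) {t : ℝ}
    (ht : 0 ≤ t) : ∀ᵐ v ∂(dilate μ t), ‖v‖ ≤ C * t := by
  rw [dilate, ae_map_iff (measurable_smul_plane t).aemeasurable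
    (measurableSet_le measurable_norm measurable_const)]
  filter_upwards [hμ] with v hv
  rw [norm_smul, Real.norm_of_nonneg ht, mul_comm]
  exact mul_le_mul_of_nonneg_right hv ht

/-! ### Near invariance of absolutely continuous averages -/

/-- Translation is continuous in `L¹`. -/
lemma exists_integral_translate_sub_lt {g : Plane → ℝ} (hg : Integrable g) {ε : ℝ} (hε : 0 < ε) :
    ∃ ρ > 0, ∀ v : Plane, ‖v‖ ≤ ρ → ∫ x, ‖g (v + x) - g x‖ ≤ ε := by
  have : Fact ((1 : ENNReal) ≠ ⊤) := ⟨by simp⟩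
  set G : Lp ℝ 1 (volume : Measure Plane) := hg.toL1 g
  have hc : Continuous fun v : Plane => DomAddAct.mk v +ᵥ G :=
    (DomAddAct.continuous_mk).vadd continuous_const
  obtain ⟨ρ, hρ, h⟩ := Metric.continuous_iff.1 hc 0 ε hε
  refine ⟨ρ / 2, by positivity, fun v hv => ?_⟩
  have h1 := (h v (by rw [dist_zero_right]; linarith)).le
  rw [DomAddAct.mk_zero, zero_vadd, dist_eq_norm, L1.norm_eq_integral_norm] at h1
  refine le_of_eq_of_le (integral_congr_ae ?_) h1
  have hG : G =ᵐ[volume] g := hg.coeFn_toL1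
  have hG' : (fun x => G (v + x)) =ᵐ[volume] fun x => g (v + x) :=
    (measurePreserving_add_left volume v).quasiMeasurePreserving.ae_eq_comp hG
  filter_upwards [hG, hG', DomAddAct.vadd_Lp_ae_eq (DomAddAct.mk v) G,
    Lp.coeFn_sub (DomAddAct.mk v +ᵥ G) G] with x h1 h2 h3 h4
  rw [h4, Pi.sub_apply, h3, h1, ← h2]
  rfl

lemma avg_dilate_apply (μ : Measure Plane) [IsProbabilityMeasure μ] (t : ℝ) (h : PlaneL2) :
    avg (dilate μ t) h = ∫ v, shift (t • v) h ∂μ :=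
  integral_map (measurable_smul_plane t).aemeasurable (continuous_shift h).aestronglyMeasurable

/-- The averages against the dilates of an absolutely continuous measure are nearly invariant
under translations that are small in comparison with the dilation factor. -/
lemma exists_norm_shift_avg_dilate_sub_le (m : Measure Plane) [IsProbabilityMeasure m]
    (hm : m ≪ volume) {ε : ℝ} (hε : 0 < ε) :
    ∃ ρ > 0, ∀ t : ℝ, 0 < t → ∀ v : Plane, ‖v‖ ≤ ρ * t → ∀ h : PlaneL2,
      ‖shift v (avg (dilate m t) h) - avg (dilate m t) h‖ ≤ ε * ‖h‖ := by
  set g : Plane → ℝ := fun x => (m.rnDeriv volume x).toReal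
  have hg : Integrable g := Measure.integrable_toReal_rnDeriv
  obtain ⟨ρ, hρ, H⟩ := exists_integral_translate_sub_lt hg hε
  refine ⟨ρ, hρ, fun t ht v hv h => ?_⟩
  have hcont : Continuous fun x : Plane => shift (t • x) h :=
    (continuous_shift h).comp (continuous_const_smul t)
  have hint : ∀ k : Plane → ℝ, Integrable k → Integrable fun x => k x • shift (t • x) h :=
    fun k hk => hk.smul_bdd ‖h‖ hcont.aestronglyMeasurable (.of_forall fun x => by simp)
  -- Substituting in the integral moves the translation by `v` onto the density of `m`, rescaled by
  -- `t⁻¹`. Hence `ρ` depends only on `m` and `ε`, not on `t` or `h`.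
  set w : Plane := -(t⁻¹ • v)
  have hgw : Integrable fun x => g (w + x) := hg.comp_add_left w
  have e1 : avg (dilate m t) h = ∫ x, g x • shift (t • x) h := by
    rw [avg_dilate_apply, integral_rnDeriv_smul hm]
  have e2 : shift v (avg (dilate m t) h) = ∫ x, g (w + x) • shift (t • x) h := by
    rw [e1]
    refine ((shift v).toContinuousLinearMap.integral_comp_comm (hint g hg)).symm.trans ?_
    rw [← integral_add_left_eq_self _ w]
    refine integral_congr_ae (.of_forall fun x => ?_)
    simp only [LinearIsometry.coe_toContinuousLinearMap, map_smul, shift_shift]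
    congr 3
    simp [w, smul_smul, ht.ne']
  rw [e2, e1, ← integral_sub (hint _ hgw) (hint g hg)]
  have hw : ‖w‖ ≤ ρ := by
    rw [norm_neg, norm_smul, norm_inv, Real.norm_of_nonneg ht.le, inv_mul_le_iff₀ ht]
    linarith
  calc _ ≤ ∫ x, ‖g (w + x) • shift (t • x) h - g x • shift (t • x) h‖ :=
        norm_integral_le_integral_norm _
    _ = ∫ x, ‖g (w + x) - g x‖ * ‖h‖ := by
        simp only [← sub_smul, norm_smul, LinearIsometry.norm_map]
    _ = (∫ x, ‖g (w + x) - g x‖) * ‖h‖ := integral_mul_const _ _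
    _ ≤ ε * ‖h‖ := mul_le_mul_of_nonneg_right (H w hw) (norm_nonneg h)

/-! ### Absolute continuity of the circle convolved with itself -/

/-- The sum of two points of the unit circle, in terms of their angles. -/
noncomputable def angleSum (p : ℝ × ℝ) : ℝ × ℝ :=
  (Real.cos p.1 + Real.cos p.2, Real.sin p.1 + Real.sin p.2)

lemma contDiff_angleSum : ContDiff ℝ 1 angleSum := by
  unfold angleSum
  fun_prop

/-- The Jacobian determinant at `p` is `sin (p.2 - p.1)`. -/
lemma exists_hasFDerivAt_angleSum {p : ℝ × ℝ} (hp : Real.sin (p.2 - p.1) ≠ 0) :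
    ∃ L : (ℝ × ℝ) ≃L[ℝ] (ℝ × ℝ), HasFDerivAt angleSum (L : (ℝ × ℝ) →L[ℝ] (ℝ × ℝ)) p := by
  have h1 : HasFDerivAt (fun q : ℝ × ℝ => q.1) (ContinuousLinearMap.fst ℝ ℝ ℝ) p := hasFDerivAt_fst
  have h2 : HasFDerivAt (fun q : ℝ × ℝ => q.2) (ContinuousLinearMap.snd ℝ ℝ ℝ) p := hasFDerivAt_snd
  have hD := (h1.cos.add h2.cos).prodMk (h1.sin.add h2.sin)
  set D := ((-Real.sin p.1) • ContinuousLinearMap.fst ℝ ℝ ℝ +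
    (-Real.sin p.2) • ContinuousLinearMap.snd ℝ ℝ ℝ).prod
    (Real.cos p.1 • ContinuousLinearMap.fst ℝ ℝ ℝ + Real.cos p.2 • ContinuousLinearMap.snd ℝ ℝ ℝ)
    with hDdef
  have hinj : Function.Injective (D : (ℝ × ℝ) →ₗ[ℝ] (ℝ × ℝ)) := by
    rw [← LinearMap.ker_eq_bot, LinearMap.ker_eq_bot']
    rintro ⟨x, y⟩ hxy
    simp only [hDdef, ContinuousLinearMap.coe_coe, ContinuousLinearMap.prod_apply,
      add_apply, smul_apply, ContinuousLinearMap.coe_fst',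
      ContinuousLinearMap.coe_snd', smul_eq_mul, Prod.mk_eq_zero] at hxy
    obtain ⟨ha, hb⟩ := hxy
    rw [Real.sin_sub] at hp
    have hx : (Real.sin p.2 * Real.cos p.1 - Real.cos p.2 * Real.sin p.1) * x = 0 := by
      linear_combination Real.cos p.2 * ha + Real.sin p.2 * hb
    have hy : (Real.sin p.2 * Real.cos p.1 - Real.cos p.2 * Real.sin p.1) * y = 0 := by
      linear_combination -Real.cos p.1 * ha - Real.sin p.1 * hb
    simp only [mul_eq_zero, hp, false_or] at hx hy
    rw [hx, hy, Prod.mk_zero_zero]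
  refine ⟨(LinearEquiv.ofInjectiveEndo _ hinj).toContinuousLinearEquiv, ?_⟩
  convert! hD using 1

/-- A `C¹` map with almost everywhere invertible derivative pulls null sets back to null sets. -/
lemma preimage_null_of_contDiff {E : Type*} [NormedAddCommGroup E] [NormedSpace ℝ E]
    [FiniteDimensional ℝ E] [MeasurableSpace E] [BorelSpace E] (μ : Measure E) [μ.IsAddHaarMeasure]
    {f : E → E} (hf : ContDiff ℝ 1 f)
    (hf' : ∀ᵐ x ∂μ, ∃ L : E ≃L[ℝ] E, HasFDerivAt f (L : E →L[ℝ] E) x)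
    {N : Set E} (hN : μ N = 0) : μ (f ⁻¹' N) = 0 := by
  have : CompleteSpace E := FiniteDimensional.complete ℝ E
  have : ProperSpace E := FiniteDimensional.proper ℝ E
  set s : Set E := {x | ∃ L : E ≃L[ℝ] E, HasFDerivAt f (L : E →L[ℝ] E) x}
  have hs : μ (f ⁻¹' N ∩ s) = 0 := by
    -- Near a point of `s`, the preimage of `N` lies in the image of a null set under the local
    -- inverse, and differentiable maps send null sets to null sets.
    refine measure_null_of_locally_null _ fun x hx => ?_
    obtain ⟨L, hL⟩ := hx.2
    have hc : ContDiffAt ℝ 1 f x := hf.contDiffAt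
    set e := hc.toOpenPartialHomeomorph f hL one_ne_zero
    have hinv : ContDiffAt ℝ 1 e.symm (f x) := hc.to_localInverse hL one_ne_zero
    have hev : ∀ᶠ y in nhds (f x), DifferentiableAt ℝ e.symm y :=
      (hinv.eventually (by simp)).mono fun y hy => hy.differentiableAt one_ne_zero
    refine ⟨f ⁻¹' N ∩ s ∩ (e.source ∩ f ⁻¹' {y | DifferentiableAt ℝ e.symm y}),
      Filter.inter_mem self_mem_nhdsWithin (mem_nhdsWithin_of_mem_nhds (Filter.inter_mem ?_ ?_)), ?_⟩
    · exact e.open_source.mem_nhds (hc.mem_toOpenPartialHomeomorph_source hL one_ne_zero)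
    · exact hf.continuous.continuousAt hev
    refine measure_mono_null (t := e.symm '' (N ∩ {y | DifferentiableAt ℝ e.symm y})) ?_ ?_
    · rintro y ⟨⟨hyN, -⟩, hy, hyd⟩
      exact ⟨f y, ⟨hyN, hyd⟩, e.left_inv hy⟩
    · exact addHaar_image_eq_zero_of_differentiableOn_of_addHaar_eq_zero μ
        (fun y hy => hy.2.differentiableWithinAt) (measure_mono_null Set.inter_subset_left hN)
  refine measure_mono_null (t := f ⁻¹' N ∩ s ∪ sᶜ) (fun x hx => ?_) (measure_union_null hs hf')
  by_cases h : x ∈ s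
  exacts [.inl ⟨hx, h⟩, .inr h]

lemma ae_sin_sub_ne_zero : ∀ᵐ p : ℝ × ℝ, Real.sin (p.2 - p.1) ≠ 0 := by
  have hmeas : MeasurableSet {p : ℝ × ℝ | Real.sin (p.2 - p.1) = 0} :=
    (isClosed_eq (by fun_prop) continuous_const).measurableSet
  rw [ae_iff]
  simp only [not_not]
  rw [Measure.volume_eq_prod, Measure.measure_prod_null hmeas]
  refine .of_forall fun x => Set.Countable.measure_zero ?_ _
  refine (Set.countable_range fun n : ℤ => n * Real.pi + x).mono fun y hy => ?_
  obtain ⟨n, hn⟩ := Real.sin_eq_zero_iff.1 hy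
  exact ⟨n, by simp only [hn]; ring⟩

lemma volume_preimage_angleSum {N : Set (ℝ × ℝ)} (hN : volume N = 0) :
    volume (angleSum ⁻¹' N) = 0 := by
  refine preimage_null_of_contDiff volume contDiff_angleSum ?_ hN
  filter_upwards [ae_sin_sub_ne_zero] with p hp using exists_hasFDerivAt_angleSum hp

/-- The unit vector with a given angle. -/
noncomputable def unitVector (θ : ℝ) : Plane := !₂[Real.cos θ, Real.sin θ]

lemma continuous_unitVector : Continuous unitVector := by
  refine (PiLp.continuous_toLp 2 _).comp (continuous_pi fun i => ?_)
  fin_cases i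
  exacts [Real.continuous_cos, Real.continuous_sin]

lemma circleMeasure_eq : circleMeasure = (ENNReal.ofReal (2 * Real.pi))⁻¹ •
    (volume.restrict (Set.Ioc 0 (2 * Real.pi))).map unitVector := rfl

lemma norm_unitVector (θ : ℝ) : ‖unitVector θ‖ = 1 := by
  simp [unitVector, EuclideanSpace.norm_eq]

instance isProbabilityMeasure_circleMeasure : IsProbabilityMeasure circleMeasure := by
  refine ⟨?_⟩
  have h : ENNReal.ofReal (2 * Real.pi) ≠ 0 := by simp [Real.pi_pos]
  rw [circleMeasure_eq, Measure.smul_apply,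
    Measure.map_apply continuous_unitVector.measurable .univ]
  simpa using ENNReal.inv_mul_cancel h ENNReal.ofReal_ne_top

/-- The bound 2 is not sharp; it is chosen to serve the circle and the square alike. -/
lemma ae_circleMeasure_norm_le : ∀ᵐ v ∂circleMeasure, ‖v‖ ≤ 2 := by
  rw [circleMeasure_eq]
  refine Measure.ae_smul_measure ?_ _
  rw [ae_map_iff continuous_unitVector.measurable.aemeasurable
    (measurableSet_le measurable_norm measurable_const)]
  exact .of_forall fun θ => by simp [norm_unitVector]

/-- The convolution square of the arclength measure on the circle is absolutely continuous. -/
lemma circleMeasure_conv_self_absolutelyContinuous :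
    circleMeasure.conv circleMeasure ≪ volume := by
  refine Measure.AbsolutelyContinuous.mk fun N hNm hN => ?_
  have hu : Measurable unitVector := continuous_unitVector.measurable
  set ν : Measure ℝ := volume.restrict (Set.Ioc 0 (2 * Real.pi))
  have hν : (ν.prod ν) ((fun p : ℝ × ℝ => unitVector p.1 + unitVector p.2) ⁻¹' N) = 0 := by
    have hac : ν.prod ν ≪ (volume : Measure (ℝ × ℝ)) :=
      Measure.restrict_le_self.absolutelyContinuous.prod
        Measure.restrict_le_self.absolutelyContinuous
    refine hac ?_
    let q : ℝ × ℝ → Plane := fun p => !₂[p.1, p.2]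
    have hq : MeasurePreserving q volume volume :=
      (PiLp.volume_preserving_toLp (Fin 2)).comp (volume_preserving_finTwoArrow ℝ).symm
    have : (fun p : ℝ × ℝ => unitVector p.1 + unitVector p.2) ⁻¹' N
        = angleSum ⁻¹' (q ⁻¹' N) := by
      ext p
      have : unitVector p.1 + unitVector p.2 = q (angleSum p) := by
        ext i
        fin_cases i <;> simp [unitVector, q, angleSum]
      simp only [Set.mem_preimage, this]
    rw [this]
    exact volume_preimage_angleSum ((hq.measure_preimage hNm.nullMeasurableSet).trans hN)
  rw [circleMeasure_eq, Measure.conv_smul_left]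
  rw [Measure.smul_apply, smul_eq_mul, Measure.conv_smul_right]
  rw [Measure.smul_apply, show (ν.map unitVector).conv (ν.map unitVector) =
      ((ν.map unitVector).prod (ν.map unitVector)).map fun x => x.1 + x.2 from rfl,
    Measure.map_prod_map _ _ hu hu, Measure.map_map (by fun_prop) (by fun_prop),
    Measure.map_apply (by fun_prop) hNm]
  refine mul_eq_zero_of_right _ (mul_eq_zero_of_right _ hν)

lemma unitVector_add_pi (θ : ℝ) : unitVector (θ + Real.pi) = -unitVector θ := by
  ext i
  fin_cases i <;> simp [unitVector]

instance isNegInvariant_circleMeasure : circleMeasure.IsNegInvariant := by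
  refine ⟨?_⟩
  have hu : Measurable unitVector := continuous_unitVector.measurable
  rw [circleMeasure_eq, Measure.neg, Measure.map_smul, Measure.map_map measurable_neg hu]
  congr 1
  ext N hN
  rw [Measure.map_apply (by fun_prop) hN, Measure.map_apply hu hN,
    Measure.restrict_apply (by measurability), Measure.restrict_apply (hu hN)]
  have hpi : (0 : ℝ) < 2 * Real.pi := by positivity
  -- Negation is rotation by `π`, which carries `(0, 2π]` to `(π, 3π]`. Both are fundamental domains
  -- for `2πℤ`, so the periodic preimage of `N` has equal measure in each.
  have h := (isAddFundamentalDomain_Ioc hpi 0 volume).measure_set_eq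
    (isAddFundamentalDomain_Ioc hpi Real.pi volume) (hu hN) (by
      rintro ⟨g, n, rfl⟩
      ext θ
      have : unitVector (n • (2 * Real.pi) + θ) = unitVector θ := by
        simp [unitVector, add_comm _ θ, Real.cos_add_int_mul_two_pi, Real.sin_add_int_mul_two_pi]
      change unitVector (n • (2 * Real.pi) + θ) ∈ N ↔ unitVector θ ∈ N
      rw [this])
  rw [zero_add] at h
  rw [h, ← (measurePreserving_add_right volume Real.pi).measure_preimage
    ((hu hN).inter measurableSet_Ioc).nullMeasurableSet]
  congr 1
  ext θ
  simp only [Set.mem_inter_iff, Set.mem_preimage, Function.comp_apply, Set.mem_Ioc,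
    unitVector_add_pi]
  refine and_congr_right fun _ => ?_
  constructor <;> rintro ⟨h1, h2⟩ <;> constructor <;> linarith

/-! ### The uniform measure on the square -/

/-- The uniform probability measure on the square `[-1, 1]²`. -/
noncomputable def squareMeasure : Measure Plane :=
  ENNReal.ofReal (1 / 4) • volume.restrict (centredSquare 1)

lemma square_eq_preimage (z : Plane) (R : ℝ) :
    square z R = WithLp.ofLp ⁻¹' Set.Icc z.ofLp fun i => z i + R := by
  ext x
  simp only [square, Set.mem_ofPred_eq, Set.mem_Icc, Set.mem_preimage, Pi.le_def]
  exact forall_and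

lemma centredSquare_eq_preimage (r : ℝ) :
    centredSquare r = WithLp.ofLp ⁻¹' Set.Icc (fun _ : Fin 2 => -r) fun _ => r := by
  ext x
  simp only [centredSquare, Set.mem_ofPred_eq, Set.mem_Icc, Set.mem_preimage, Pi.le_def]
  exact forall_and

lemma measurableSet_square (z : Plane) (R : ℝ) : MeasurableSet (square z R) := by
  rw [square_eq_preimage]
  exact (PiLp.volume_preserving_ofLp (Fin 2)).measurable measurableSet_Icc

lemma measurableSet_centredSquare (r : ℝ) : MeasurableSet (centredSquare r) := by
  rw [centredSquare_eq_preimage]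
  exact (PiLp.volume_preserving_ofLp (Fin 2)).measurable measurableSet_Icc

lemma volume_square (z : Plane) {R : ℝ} (hR : 0 ≤ R) :
    volume (square z R) = ENNReal.ofReal (R ^ 2) := by
  rw [square_eq_preimage, (PiLp.volume_preserving_ofLp (Fin 2)).measure_preimage
    measurableSet_Icc.nullMeasurableSet, Real.volume_Icc_pi]
  simp [ENNReal.ofReal_pow hR]

lemma volume_centredSquare_one : volume (centredSquare 1) = ENNReal.ofReal 4 := by
  rw [centredSquare_eq_preimage, (PiLp.volume_preserving_ofLp (Fin 2)).measure_preimage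
    measurableSet_Icc.nullMeasurableSet, Real.volume_Icc_pi]
  simp only [sub_neg_eq_add, Finset.prod_const, Finset.card_univ, Fintype.card_fin]
  rw [← ENNReal.ofReal_pow (by norm_num)]
  norm_num

instance isProbabilityMeasure_squareMeasure : IsProbabilityMeasure squareMeasure := by
  refine ⟨?_⟩
  rw [squareMeasure, Measure.smul_apply, Measure.restrict_apply_univ, volume_centredSquare_one,
    smul_eq_mul, ← ENNReal.ofReal_mul (by norm_num)]
  norm_num

lemma neg_mem_centredSquare {r : ℝ} {v : Plane} : -v ∈ centredSquare r ↔ v ∈ centredSquare r := by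
  refine forall_congr' fun i => ?_
  simp only [PiLp.neg_apply, Set.mem_Icc]
  constructor <;> rintro ⟨h1, h2⟩ <;> constructor <;> linarith

instance isNegInvariant_squareMeasure : squareMeasure.IsNegInvariant := by
  refine ⟨?_⟩
  have h := (Measure.measurePreserving_neg (volume : Measure Plane)).restrict_preimage
    (measurableSet_centredSquare 1)
  have h' : (Neg.neg : Plane → Plane) ⁻¹' centredSquare 1 = centredSquare 1 := by
    ext v
    exact neg_mem_centredSquare
  rw [h'] at h
  rw [squareMeasure, Measure.neg, Measure.map_smul, h.map_eq]

lemma squareMeasure_absolutelyContinuous : squareMeasure ≪ volume :=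
  (Measure.smul_absolutelyContinuous).trans Measure.restrict_le_self.absolutelyContinuous

lemma ae_squareMeasure_norm_le : ∀ᵐ v ∂squareMeasure, ‖v‖ ≤ 2 := by
  refine Measure.ae_smul_measure ?_ _
  filter_upwards [ae_restrict_mem (measurableSet_centredSquare 1)] with v hv
  rw [EuclideanSpace.norm_eq, Real.sqrt_le_left (by norm_num), Fin.sum_univ_two]
  have h0 := sq_le_one_iff_abs_le_one (v 0) |>.2 (abs_le.2 (hv 0))
  have h1 := sq_le_one_iff_abs_le_one (v 1) |>.2 (abs_le.2 (hv 1))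
  simp only [Real.norm_eq_abs, sq_abs]
  linarith

/-! ### Discrepancy operators and almost orthogonality -/

/-- The difference of the averages over the circle of radius `t` and the square `[-t, t]²`. -/
noncomputable def discrepancy (t : ℝ) : PlaneL2 →L[ℝ] PlaneL2 :=
  avg (dilate circleMeasure t) - avg (dilate squareMeasure t)

lemma discrepancy_apply (t : ℝ) (h : PlaneL2) :
    discrepancy t h = avg (dilate circleMeasure t) h - avg (dilate squareMeasure t) h := rfl

lemma norm_discrepancy_le (t : ℝ) (h : PlaneL2) : ‖discrepancy t h‖ ≤ 2 * ‖h‖ := by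
  rw [discrepancy_apply, two_mul]
  exact (norm_sub_le _ _).trans (add_le_add (norm_avg_le _ h) (norm_avg_le _ h))

lemma discrepancy_symmetric (t : ℝ) (f h : PlaneL2) :
    inner ℝ (discrepancy t f) h = inner ℝ f (discrepancy t h) := by
  simp only [discrepancy_apply, inner_sub_left, inner_sub_right, avg_symmetric]

lemma discrepancy_comm (s t : ℝ) (h : PlaneL2) :
    discrepancy s (discrepancy t h) = discrepancy t (discrepancy s h) := by
  simp only [discrepancy_apply, map_sub]
  rw [avg_comm (dilate circleMeasure s) (dilate circleMeasure t),
    avg_comm (dilate circleMeasure s) (dilate squareMeasure t),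
    avg_comm (dilate squareMeasure s) (dilate circleMeasure t),
    avg_comm (dilate squareMeasure s) (dilate squareMeasure t)]
  abel

/-- Both measures have mass one, so `g` can be subtracted from each average without changing the
difference. -/
lemma norm_discrepancy_le_of_shift {t : ℝ} (ht : 0 ≤ t) {g : PlaneL2} {C : ℝ}
    (hg : ∀ v : Plane, ‖v‖ ≤ 2 * t → ‖shift v g - g‖ ≤ C) : ‖discrepancy t g‖ ≤ 2 * C := by
  have h1 := norm_avg_sub_self_le (dilate circleMeasure t) (g := g)
    ((ae_dilate_norm_le ae_circleMeasure_norm_le ht).mono hg)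
  have h2 := norm_avg_sub_self_le (dilate squareMeasure t) (g := g)
    ((ae_dilate_norm_le ae_squareMeasure_norm_le ht).mono hg)
  calc ‖discrepancy t g‖
      = ‖(avg (dilate circleMeasure t) g - g) - (avg (dilate squareMeasure t) g - g)‖ := by
        rw [discrepancy_apply]; congr 1; abel
    _ ≤ 2 * C := (norm_sub_le _ _).trans (by linarith)

/-- The averages at a small scale against a twice-averaged function at a large scale. -/
lemma exists_norm_discrepancy_discrepancy_sq_le {ε : ℝ} (hε : 0 < ε) :
    ∃ ρ > 0, ∀ s t : ℝ, 0 < s → s ≤ ρ * t → ∀ h : PlaneL2,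
      ‖discrepancy s (discrepancy t (discrepancy t h))‖ ≤ ε * ‖h‖ := by
  -- The square of the discrepancy has four terms, each costing twice this amount.
  have hε' : 0 < ε / 8 := by positivity
  obtain ⟨ρ₁, hρ₁, H₁⟩ := exists_norm_shift_avg_dilate_sub_le
    (circleMeasure.conv circleMeasure) circleMeasure_conv_self_absolutelyContinuous hε'
  obtain ⟨ρ₂, hρ₂, H₂⟩ := exists_norm_shift_avg_dilate_sub_le
    (circleMeasure.conv squareMeasure)
    (Measure.conv_absolutelyContinuous squareMeasure_absolutelyContinuous) hε'
  obtain ⟨ρ₃, hρ₃, H₃⟩ := exists_norm_shift_avg_dilate_sub_le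
    (squareMeasure.conv squareMeasure)
    (Measure.conv_absolutelyContinuous squareMeasure_absolutelyContinuous) hε'
  set ρ := min ρ₁ (min ρ₂ ρ₃)
  have hρ : 0 < ρ := by positivity
  -- Halved because the measures at scale `s` live in the ball of radius `2 * s`.
  refine ⟨ρ / 2, by positivity, fun s t hs hst h => ?_⟩
  have ht : 0 < t := pos_of_mul_pos_right (hs.trans_le hst) (by positivity)
  have key : ∀ {ρ' : ℝ} {m : Measure Plane} [IsProbabilityMeasure m], ρ ≤ ρ' →
      (∀ t : ℝ, 0 < t → ∀ v : Plane, ‖v‖ ≤ ρ' * t → ∀ h : PlaneL2,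
        ‖shift v (avg (dilate m t) h) - avg (dilate m t) h‖ ≤ ε / 8 * ‖h‖) →
      ‖discrepancy s (avg (dilate m t) h)‖ ≤ 2 * (ε / 8 * ‖h‖) := by
    intro ρ' m _ hρ' H
    refine norm_discrepancy_le_of_shift hs.le fun v hv => H t ht v (hv.trans ?_) h
    have := mul_le_mul_of_nonneg_right hρ' ht.le
    linarith
  have k₁ := key (min_le_left _ _) H₁
  have k₂ := key ((min_le_right _ _).trans (min_le_left _ _)) H₂
  have k₃ := key ((min_le_right _ _).trans (min_le_right _ _)) H₃
  have e : discrepancy t (discrepancy t h) =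
      avg (dilate (circleMeasure.conv circleMeasure) t) h
      - avg (dilate (circleMeasure.conv squareMeasure) t) h
      - (avg (dilate (circleMeasure.conv squareMeasure) t) h
        - avg (dilate (squareMeasure.conv squareMeasure) t) h) := by
    simp only [dilate_conv, ← avg_avg, discrepancy_apply, map_sub]
    rw [avg_comm (dilate squareMeasure t) (dilate circleMeasure t)]
  rw [e, map_sub, map_sub, map_sub]
  refine (norm_sub_le _ _).trans ((add_le_add (norm_sub_le _ _) (norm_sub_le _ _)).trans ?_)
  linarith

/-- Almost orthogonality for commuting symmetric operators. -/
lemma norm_sum_sq_le_of_almost_orthogonal {H : Type*} [NormedAddCommGroup H]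
    [InnerProductSpace ℝ H] {K : ℕ} (N : Fin K → H → H) {κ : ℝ} (hκ : 0 ≤ κ)
    (hbound : ∀ i h, ‖N i h‖ ≤ 2 * ‖h‖)
    (hsymm : ∀ i f h, inner ℝ (N i f) h = inner ℝ f (N i h))
    (hcomm : ∀ i j h, N i (N j h) = N j (N i h))
    (hsmall : ∀ i j, i < j → ∀ h, ‖N i (N j (N j h))‖ ≤ κ ^ 2 / 2 * ‖h‖) (h : H) :
    ‖∑ i, N i h‖ ^ 2 ≤ (4 * K + κ * K ^ 2) * ‖h‖ ^ 2 := by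
  have hlt : ∀ i j, i < j → inner ℝ (N i h) (N j h) ≤ κ * ‖h‖ ^ 2 := by
    intro i j hij
    have h1 : ‖N i (N j h)‖ ^ 2 ≤ (κ * ‖h‖) ^ 2 := by
      -- Moving one `N j` across the inner product creates the square of `N j` that `hsmall`
      -- controls.
      have e : inner ℝ (N i (N j h)) (N i (N j h)) = inner ℝ (N i h) (N i (N j (N j h))) := by
        rw [hcomm i j h, hsymm, ← hcomm i j, ← hcomm i j]
      rw [← real_inner_self_eq_norm_sq, e]
      refine (real_inner_le_norm _ _).trans ?_
      calc _ ≤ (2 * ‖h‖) * (κ ^ 2 / 2 * ‖h‖) :=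
            mul_le_mul (hbound i h) (hsmall i j hij h) (norm_nonneg _) (by positivity)
        _ = _ := by ring
    have h2 := le_of_sq_le_sq h1 (by positivity)
    calc inner ℝ (N i h) (N j h) = inner ℝ h (N i (N j h)) := hsymm _ _ _
      _ ≤ ‖h‖ * ‖N i (N j h)‖ := real_inner_le_norm _ _
      _ ≤ ‖h‖ * (κ * ‖h‖) := mul_le_mul_of_nonneg_left h2 (norm_nonneg _)
      _ = κ * ‖h‖ ^ 2 := by ring
  have hall : ∀ i j, inner ℝ (N i h) (N j h) ≤
      (if i = j then 4 * ‖h‖ ^ 2 else 0) + κ * ‖h‖ ^ 2 := by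
    intro i j
    rcases lt_trichotomy i j with hij | rfl | hij
    · simpa [hij.ne] using hlt i j hij
    · have := pow_le_pow_left₀ (norm_nonneg _) (hbound i h) 2
      rw [real_inner_self_eq_norm_sq, if_pos rfl]
      nlinarith [mul_nonneg hκ (sq_nonneg ‖h‖)]
    · rw [real_inner_comm]
      simpa [hij.ne'] using hlt j i hij
  rw [← real_inner_self_eq_norm_sq, sum_inner]
  simp only [inner_sum]
  refine (Finset.sum_le_sum fun i _ => Finset.sum_le_sum fun j _ => hall i j).trans_eq ?_
  simp only [Finset.sum_add_distrib, Finset.sum_ite_eq, Finset.mem_univ, if_true,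
    Finset.sum_const, Finset.card_univ, Fintype.card_fin, nsmul_eq_mul]
  ring

/-- The sum of the discrepancies over sufficiently many well-separated scales is small. -/
lemma exists_norm_sum_discrepancy_le {η : ℝ} (hη : 0 < η) :
    ∃ K : ℕ, 0 < K ∧ ∃ ρ > 0, ∀ l : Fin K → ℝ, (∀ i, 0 < l i) →
      (∀ i j, i < j → l i ≤ ρ * l j) → ∀ h : PlaneL2,
      ‖∑ i, discrepancy (l i) h‖ ≤ η * K * ‖h‖ := by
  set κ := η ^ 2 / 2
  have hκ : 0 < κ := by positivity
  obtain ⟨ρ, hρ, H⟩ := exists_norm_discrepancy_discrepancy_sq_le (ε := κ ^ 2 / 2) (by positivity)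
  -- With `κ = η² / 2`, the diagonal `4 * K` must fit in the other half of `η² * K²`.
  obtain ⟨K, hK⟩ := exists_nat_gt (8 / η ^ 2)
  have hK0 : (0 : ℝ) < K := lt_trans (by positivity) hK
  refine ⟨K, by exact_mod_cast hK0, ρ, hρ, fun l hl hsep h => ?_⟩
  have h1 := norm_sum_sq_le_of_almost_orthogonal (fun i h => discrepancy (l i) h) hκ.le
    (fun i => norm_discrepancy_le (l i)) (fun i => discrepancy_symmetric (l i))
    (fun i j => discrepancy_comm (l i) (l j))
    (fun i j hij => H (l i) (l j) (hl i) (hsep i j hij)) h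
  refine le_of_sq_le_sq (h1.trans ?_) (by positivity)
  rw [mul_pow]
  refine mul_le_mul_of_nonneg_right ?_ (by positivity)
  rw [div_lt_iff₀ (by positivity)] at hK
  have : κ * (K : ℝ) ^ 2 = η ^ 2 / 2 * (K : ℝ) ^ 2 := rfl
  nlinarith

/-! ### Counting forms as inner products -/

/-- The form `∫ ∫ 1_A(x) 1_B(x + v) dμ(v) dx`. -/
noncomputable def pairForm (A B : Set Plane) (μ : Measure Plane) : ℝ :=
  ∫ x, ∫ v, ind A x * ind B (x + v) ∂μ

lemma ind_nonneg (A : Set Plane) (x : Plane) : 0 ≤ ind A x :=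
  Set.indicator_nonneg (fun _ _ => zero_le_one) x

lemma ind_le_one (A : Set Plane) (x : Plane) : ind A x ≤ 1 :=
  Set.indicator_le_self' (f := fun _ => (1 : ℝ)) (fun _ _ => zero_le_one) x

lemma norm_ind_le_one (A : Set Plane) (x : Plane) : ‖ind A x‖ ≤ 1 := by
  rw [Real.norm_of_nonneg (ind_nonneg A x)]
  exact ind_le_one A x

lemma norm_ind_mono {A B : Set Plane} (h : A ⊆ B) (x : Plane) : ‖ind A x‖ ≤ ‖ind B x‖ := by
  rw [Real.norm_of_nonneg (ind_nonneg A x), Real.norm_of_nonneg (ind_nonneg B x)]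
  exact Set.indicator_le_indicator_of_subset h (fun _ => zero_le_one) x

lemma aestronglyMeasurable_ind {A : Set Plane} (hA : NullMeasurableSet A volume) :
    AEStronglyMeasurable (ind A) volume :=
  aestronglyMeasurable_const.indicator₀ hA

lemma memLp_ind_square (z : Plane) {R : ℝ} (hR : 0 ≤ R) (p : ENNReal) :
    MemLp (ind (square z R)) p volume :=
  memLp_indicator_const p (measurableSet_square z R) 1
    (.inr (by rw [volume_square z hR]; exact ENNReal.ofReal_ne_top))

lemma memLp_ind {A : Set Plane} (hA : NullMeasurableSet A volume) {z : Plane} {R : ℝ}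
    (hR : 0 ≤ R) (hAR : A ⊆ square z R) (p : ENNReal) : MemLp (ind A) p volume :=
  (memLp_ind_square z hR p).mono (aestronglyMeasurable_ind hA) (.of_forall (norm_ind_mono hAR))

lemma norm_toLp_ind_le {A : Set Plane} {z : Plane} {R : ℝ} (hR : 0 ≤ R) (hAR : A ⊆ square z R)
    (hA : MemLp (ind A) 2 volume) : ‖hA.toLp (ind A)‖ ≤ R := by
  refine (ENNReal.toReal_mono ENNReal.ofReal_ne_top ?_).trans_eq (ENNReal.toReal_ofReal hR)
  rw [eLpNorm_congr_ae hA.coeFn_toLp]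
  refine (eLpNorm_mono (norm_ind_mono hAR)).trans_eq ?_
  rw [show ind (square z R) = (square z R).indicator fun _ => (1 : ℝ) from rfl,
    eLpNorm_indicator_const (measurableSet_square z R) (by simp) (by simp), volume_square z hR,
    ENNReal.ofReal_rpow_of_nonneg (by positivity) (by positivity)]
  simp only [enorm_one, one_mul, ENNReal.toReal_ofNat]
  rw [← Real.sqrt_eq_rpow, Real.sqrt_sq hR]

lemma inner_avg_eq_pairForm {A B : Set Plane}
    (hB : NullMeasurableSet B volume) (hA1 : Integrable (ind A)) (hA2 : MemLp (ind A) 2 volume)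
    (hB2 : MemLp (ind B) 2 volume) (μ : Measure Plane) [IsProbabilityMeasure μ] :
    inner ℝ (hA2.toLp (ind A)) (avg μ (hB2.toLp (ind B))) = pairForm A B μ := by
  have hinner : ∀ v : Plane, inner ℝ (hA2.toLp (ind A)) (shift v (hB2.toLp (ind B))) =
      ∫ x, ind A x * ind B (x + v) := by
    intro v
    rw [L2.inner_def]
    refine integral_congr_ae ?_
    have h := (measurePreserving_add_left volume v).quasiMeasurePreserving.ae_eq_comp
      hB2.coeFn_toLp
    filter_upwards [hA2.coeFn_toLp, coeFn_shift v (hB2.toLp (ind B)), h] with x h1 h2 h3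
    simp only [Function.comp_apply] at h3
    rw [h1, h2, h3, add_comm v x]
    simp [mul_comm]
  rw [inner_avg_right, pairForm]
  simp only [hinner]
  refine (integral_integral_swap ?_).symm
  -- `B` is only null measurable and `μ` may be singular; the shear `(x, v) ↦ (v, v + x)` still
  -- preserves the product, so null sets pull back to null sets.
  have hadd : Measure.QuasiMeasurePreserving (fun p : Plane × Plane => p.1 + p.2)
      (volume.prod μ) volume := by
    have h := Measure.quasiMeasurePreserving_snd.comp
      (measurePreserving_prod_add_swap volume μ).quasiMeasurePreserving
    simpa only [Function.comp_def, add_comm] using h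
  exact (hA1.comp_fst μ).mul_bdd (c := 1) ((aestronglyMeasurable_ind hB).comp_quasiMeasurePreserving hadd)
    (.of_forall fun p => norm_ind_le_one B _)

open scoped Pointwise in
lemma smul_centredSquare_one {r : ℝ} (hr : 0 < r) : centredSquare r = r • centredSquare 1 := by
  ext v
  rw [Set.mem_smul_set_iff_inv_smul_mem₀ hr.ne']
  refine forall_congr' fun i => ?_
  simp only [PiLp.smul_apply, smul_eq_mul, Set.mem_Icc, le_inv_mul_iff₀ hr, inv_mul_le_iff₀ hr]
  simp

lemma integral_dilate_squareMeasure {r : ℝ} (hr : 0 < r) (F : Plane → ℝ) :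
    ∫ v, F v ∂(dilate squareMeasure r) = 1 / (2 * r) ^ 2 * ∫ v in centredSquare r, F v := by
  have he : MeasurableEmbedding fun v : Plane => r • v :=
    (Homeomorph.smulOfNeZero r hr.ne').measurableEmbedding
  rw [dilate, he.integral_map, squareMeasure, integral_smul_measure,
    Measure.setIntegral_comp_smul_of_pos _ _ _ hr, ← smul_centredSquare_one hr,
    ENNReal.toReal_ofReal (by norm_num), finrank_euclideanSpace_fin, smul_eq_mul, smul_eq_mul,
    ← mul_assoc]
  congr 1
  field_simp
  norm_num

lemma localPairAverage_eq_pairForm {A : Set Plane} (B : Set Plane) {z : Plane} {R r : ℝ}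
    (hAR : A ⊆ square z R) (hr : 0 < r) :
    localPairAverage A B z R r = pairForm A B (dilate squareMeasure r) := by
  have hx : ∀ x : Plane, ∫ y, ind A x * ind B y * ind (centredSquare r) (x - y) =
      ∫ v in centredSquare r, ind A x * ind B (x + v) := by
    intro x
    -- Substitute `y = x + v`; then `x - y = -v`, and the centred square is symmetric.
    rw [← integral_add_left_eq_self _ x, ← integral_indicator (measurableSet_centredSquare r)]
    refine integral_congr_ae (.of_forall fun v => ?_)
    by_cases hv : v ∈ centredSquare r <;>
      simp [ind, neg_mem_centredSquare, hv]
  rw [localPairAverage, pairForm]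
  simp only [integral_dilate_squareMeasure hr, hx]
  rw [integral_const_mul, setIntegral_eq_integral_of_forall_compl_eq_zero]
  intro x hxR
  have : ind A x = 0 := Set.indicator_of_notMem (fun h => hxR (hAR h)) _
  simp [this]

lemma localPairAverage_nonneg (A B : Set Plane) (z : Plane) (R r : ℝ) :
    0 ≤ localPairAverage A B z R r :=
  mul_nonneg (by positivity) (integral_nonneg fun x => integral_nonneg fun y =>
    mul_nonneg (mul_nonneg (ind_nonneg _ _) (ind_nonneg _ _)) (ind_nonneg _ _))

/-! ### Selection of scales and conclusion -/

lemma two_pow_mul_le_of_lacunary {J : ℕ} {l : Fin J → ℝ}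
    (hl : ∀ k k' : Fin J, (k : ℕ) + 1 = (k' : ℕ) → 2 * l k ≤ l k') (n : ℕ) :
    ∀ k k' : Fin J, (k : ℕ) + n = (k' : ℕ) → 2 ^ n * l k ≤ l k' := by
  induction n with
  | zero =>
    intro k k' h
    rw [Fin.ext (by simpa using h) (a := k) (b := k'), pow_zero, one_mul]
  | succ n ih =>
    intro k k' h
    let m : Fin J := ⟨k + n, by omega⟩
    have h1 := ih k m rfl
    have h2 := hl m k' (by simp only [m]; omega)
    calc 2 ^ (n + 1) * l k = 2 * (2 ^ n * l k) := by ring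
      _ ≤ 2 * l m := by linarith
      _ ≤ l k' := h2

theorem mainTheorem6 (δ : ℝ) (hδ : δ ∈ Set.Ioo (0 : ℝ) 1) :
    ∃ J : ℕ, 0 < J ∧ ∃ c : ℝ, 0 < c ∧
      ∀ l : Fin J → ℝ, (∀ k, 1 < l k) →
        (∀ k k' : Fin J, (k : ℕ) + 1 = (k' : ℕ) → 2 * l k ≤ l k') →
      ∀ R : ℝ, 0 < R → ∀ M : ℝ, 1 ≤ M → (∀ k, l k ∈ Set.Icc M (R / 2)) →
      ∀ z : Plane, ∀ A B : Set Plane,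
        NullMeasurableSet A volume → NullMeasurableSet B volume →
        A ⊆ square z R → B ⊆ square z R →
        δ * R ^ 2 < ⨅ r : Set.Icc M (R / 2), localPairAverage A B z R r →
        ∃ j : Fin J, c * R ^ 2 ≤ circleCount A B (l j) := by
  have hδ0 : 0 < δ := hδ.1
  obtain ⟨K, hK, ρ, hρ, H⟩ := exists_norm_sum_discrepancy_le (half_pos hδ0)
  -- Only every `(L + 1)`-th scale is kept. Kept scales then differ by a factor of at least `2 ^ L >
  -- 1 / ρ`, and the stride is positive even when `L = 0`.
  obtain ⟨L, hL⟩ := exists_pow_lt_of_lt_one hρ (by norm_num : (1 / 2 : ℝ) < 1)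
  have hbd : ∀ i : Fin K, (i : ℕ) * (L + 1) < K * (L + 1) := fun i =>
    Nat.mul_lt_mul_of_pos_right i.2 L.succ_pos
  refine ⟨K * (L + 1), by positivity, δ / 2, half_pos hδ0, ?_⟩
  intro l hl1 hlac R hR M hM hlM z A B hA hB hAR hBR hinf
  let l' : Fin K → ℝ := fun i => l ⟨i * (L + 1), hbd i⟩
  have hl0 : ∀ i, 0 < l' i := fun i => zero_lt_one.trans (hl1 _)
  have hsep : ∀ i j, i < j → l' i ≤ ρ * l' j := by
    intro i j hij
    obtain ⟨d, hd⟩ := Nat.exists_eq_add_of_lt (Fin.lt_def.1 hij)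
    have h := two_pow_mul_le_of_lacunary hlac ((d + 1) * (L + 1)) ⟨i * (L + 1), hbd i⟩
      ⟨j * (L + 1), hbd j⟩ (by simp only [hd]; ring)
    have hpow : (2 : ℝ) ^ L ≤ 2 ^ ((d + 1) * (L + 1)) :=
      pow_le_pow_right₀ one_le_two (by nlinarith [Nat.zero_le (d * (L + 1))])
    have h1 : 2 ^ L * l' i ≤ l' j := (mul_le_mul_of_nonneg_right hpow (hl0 i).le).trans h
    calc l' i = (1 / 2) ^ L * (2 ^ L * l' i) := by
          rw [← mul_assoc, ← mul_pow]; norm_num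
      _ ≤ ρ * l' j := mul_le_mul hL.le h1 (by have := hl0 i; positivity) hρ.le
  have hA2 := memLp_ind hA hR.le hAR 2
  have hB2 := memLp_ind hB hR.le hBR 2
  have hA1 : Integrable (ind A) := memLp_one_iff_integrable.1 (memLp_ind hA hR.le hAR 1)
  set f := hA2.toLp (ind A)
  set h := hB2.toLp (ind B)
  have hf : ‖f‖ ≤ R := norm_toLp_ind_le hR.le hAR hA2
  have hh : ‖h‖ ≤ R := norm_toLp_ind_le hR.le hBR hB2
  by_contra! hcon
  have hterm : ∀ i, inner ℝ f (discrepancy (l' i) h) < -(δ / 2 * R ^ 2) := by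
    intro i
    rw [discrepancy_apply, inner_sub_right, inner_avg_eq_pairForm hB hA1,
      inner_avg_eq_pairForm hB hA1, ← localPairAverage_eq_pairForm B hAR (hl0 i)]
    have h1 : pairForm A B (dilate circleMeasure (l' i)) < δ / 2 * R ^ 2 := hcon _
    -- The hypothesis on the infimum enters only here, at the kept scales.
    have h2 : δ * R ^ 2 < localPairAverage A B z R (l' i) :=
      hinf.trans_le (ciInf_le (f := fun r : Set.Icc M (R / 2) => localPairAverage A B z R r)
        ⟨0, by rintro _ ⟨r, rfl⟩; exact localPairAverage_nonneg A B z R r⟩ ⟨l' i, hlM _⟩)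
    linarith
  have : Nonempty (Fin K) := ⟨⟨0, hK⟩⟩
  have hsum : inner ℝ f (∑ i, discrepancy (l' i) h) < K * -(δ / 2 * R ^ 2) := by
    rw [inner_sum]
    refine (Finset.sum_lt_sum_of_nonempty Finset.univ_nonempty fun i _ => hterm i).trans_eq ?_
    simp
  have hlow := (abs_le.1 (abs_real_inner_le_norm f (∑ i, discrepancy (l' i) h))).1
  have hup : ‖f‖ * ‖∑ i, discrepancy (l' i) h‖ ≤ R * (δ / 2 * K * R) :=
    mul_le_mul hf ((H l' hl0 hsep h).trans (mul_le_mul_of_nonneg_left hh (by positivity)))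
      (norm_nonneg _) hR.le
  linarith
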